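/- Let $\mathcal H$ be a real separable Hilbert space with $\dim\mathcal H=\infty$, and let $I$ be its identity operator. A bounded operator $A$ is trace class if $\sum_k\langle e_k,(A^*A)^{1/2}e_k\rangle<\infty$ for an orthonormal basis $(e_k)$; then $\operatorname{tr}A=\sum_k\langle e_k,Ae_k\rangle$, and $\det(I+A)=\prod_k(1+\lambda_k(A))$ is the Fredholm determinant, where $\lambda_k(A)$ are the (complex) eigenvalues of $A$ counted with algebraic multiplicity. For $A$ trace class and $c\in\mathbb R$ put $$\operatorname{tr}_X(A+cI)=\operatorname{tr}A+c,\qquad \det\nolimits_X(A+cI)=c\,\det(I+A/c)\quad(c\neq0).$$ For positive definite operators $A+\gamma I$, $B+\mu I$ with $A,B$ self-adjoint trace class and $\gamma,\mu>0$, put $$d^1_{\mathrm{logdet}}[A+\gamma I,B+\mu I]=\Big(\frac\gamma\mu-1\Big)\log\frac\gamma\mu+\operatorname{tr}_X\big[(B+\mu I)^{-1}(A+\gamma I)-I\big]-\frac\gamma\mu\log\det\nolimits_X\big[(B+\mu I)^{-1}(A+\gamma I)\big].$$ Let $\gamma>0$ and $0<\alpha<1$ be fixed. For Gaussian measures (possibly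 degenerate) $\mu_i=\mathcal N(m_i,C_i)$ on $\mathcal H$ with means $m_i$ and covariance operators $C_i$, $i=0,1$, put $$C_{\alpha,\gamma}=\big[(1-\alpha)(C_0+\gamma I)^{-1}+\alpha(C_1+\gamma I)^{-1}\big]^{-1},\qquad m_{\alpha,\gamma}=C_{\alpha,\gamma}\big[(1-\alpha)(C_0+\gamma I)^{-1}m_0+\alpha(C_1+\gamma I)^{-1}m_1\big],$$ where $C_{\alpha,\gamma}-\gamma I$ is self-adjoint and trace class. The regularized geometric Jensen–Shannon divergence is $$\mathrm{JS}^\gamma_{G_\alpha}(\mu_0\|\mu_1)=\tfrac{1-\alpha}2\big\|C_{\alpha,\gamma}^{-1/2}(m_0-m_{\alpha,\gamma})\big\|^2+\tfrac\alpha2\big\|C_{\alpha,\gamma}^{-1/2}(m_1-m_{\alpha,\gamma})\big\|^2+\tfrac{1-\alpha}2\,d^1_{\mathrm{logdet}}[C_0+\gamma I,C_{\alpha,\gamma}]+\tfrac\alpha2\,d^1_{\mathrm{logdet}}[C_1+\gamma I,C_{\alpha,\gamma}].$$ Then, for all Gaussian measures $\mu_0,\mu_1$ on $\mathcal H$, $$\mathrm{JS}^\gamma_{G_\alpha}(\mu_0\|\mu_1)\ge0,\qquad\text{and}\qquad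 \mathrm{JS}^\gamma_{G_\alpha}(\mu_0\|\mu_1)=0\iff\mu_0=\mu_1\iff m_0=m_1\text{ and }C_0=C_1.$$ -/

import Mathlib

open MeasureTheory ProbabilityTheory
open scoped TensorProduct RealInnerProductSpace

noncomputable section

namespace RegJS

section Operators

variable {H : Type*} [NormedAddCommGroup H] [InnerProductSpace ℝ H] [CompleteSpace H]

/-- `P` is a positive (self-adjoint, `⟪P x, x⟫ ≥ 0`) square root of `A`.
A bounded positive operator has exactly one. -/
def IsPosSqrt (P A : H →L[ℝ] H) : Prop := P.IsPositive ∧ P * P = A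

open Classical in
/-- The positive square root `A^{1/2}` of a bounded positive operator `A`
(and `0` if `A` has none). -/
def posSqrt (A : H →L[ℝ] H) : H →L[ℝ] H :=
  if h : ∃ P, IsPosSqrt P A then h.choose else 0

/-- Trace class operators: `∑ₖ ⟪eₖ, |A| eₖ⟫ < ∞` in an orthonormal basis, where
`|A| = (A* A)^{1/2}`. (The terms are nonnegative and the sum does not depend on the basis.) -/
def IsTraceClass (A : H →L[ℝ] H) : Prop :=
  ∃ P : H →L[ℝ] H, IsPosSqrt P (ContinuousLinearMap.adjoint A * A) ∧
    ∃ (w : Set H) (e : HilbertBasis w ℝ H), Summable fun i : w => ⟪e i, P (e i)⟫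

variable (H) in
/-- The index set of a fixed orthonormal basis of `H`. -/
def basisSet : Set H := (exists_hilbertBasis ℝ H).choose

variable (H) in
/-- A fixed orthonormal basis of `H`, used to write down the trace. -/
def onb : HilbertBasis (basisSet H) ℝ H := (exists_hilbertBasis ℝ H).choose_spec.choose

/-- The trace `tr A = ∑ₖ ⟪eₖ, A eₖ⟫` of a trace class operator. -/
def trace (A : H →L[ℝ] H) : ℝ := ∑' i : basisSet H, ⟪onb H i, A (onb H i)⟫

/-- The algebraic multiplicity of `z : ℂ` as an eigenvalue of (the complexification of) `A`:
the dimension of the space of all `v` in `ℂ ⊗ H` with `(A - z)ⁿ v = 0` for some `n`. -/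
def algMult (A : H →L[ℝ] H) (z : ℂ) : ℕ :=
  Module.finrank ℂ (Module.End.maxGenEigenspace ((A : H →ₗ[ℝ] H).baseChange ℂ) z)

/-- The Fredholm determinant `det (I + A) = ∏ₖ (1 + λₖ(A))` of a trace class operator `A`, the
product over the eigenvalues repeated according to algebraic multiplicity. For a real operator
the nonreal eigenvalues come in conjugate pairs, so that the product is real. -/
def fredholmDet (A : H →L[ℝ] H) : ℝ := (∏' z : ℂ, (1 + z) ^ algMult A z).re

/-- Extended (unitized) trace class operators `A + c I` with `A` trace class, `c` real. -/
def IsExtTraceClass (T : H →L[ℝ] H) : Prop := ∃ c : ℝ, IsTraceClass (T - c • 1)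

open Classical in
/-- The scalar `c` of an extended trace class operator `T = A + c I`; it is unique when `H` is
infinite-dimensional. -/
def scalarPart (T : H →L[ℝ] H) : ℝ :=
  if h : IsExtTraceClass T then h.choose else 0

/-- The trace class part `A` of an extended trace class operator `T = A + c I`. -/
def tracePart (T : H →L[ℝ] H) : H →L[ℝ] H := T - scalarPart T • 1

/-- The extended trace `tr_X (A + c I) = tr A + c`. -/
def extTrace (T : H →L[ℝ] H) : ℝ := trace (tracePart T) + scalarPart T

/-- The extended Fredholm determinant `det_X (A + c I) = c det (I + A / c)`, `c ≠ 0`. -/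
def extDet (T : H →L[ℝ] H) : ℝ :=
  scalarPart T * fredholmDet ((scalarPart T)⁻¹ • tracePart T)

/-- The Log-Det divergence `d¹_logdet [T, S]` for `T = A + γ I` and `S = B + μ I` positive
definite and extended trace class:
`(γ/μ - 1) log (γ/μ) + tr_X (S⁻¹ T - I) - (γ/μ) log det_X (S⁻¹ T)`. -/
def logDetDiv (T S : H →L[ℝ] H) : ℝ :=
  (scalarPart T / scalarPart S - 1) * Real.log (scalarPart T / scalarPart S)
    + extTrace (Ring.inverse S * T - 1)
    - scalarPart T / scalarPart S * Real.log (extDet (Ring.inverse S * T))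

end Operators

section Gaussian

variable {H : Type*} [NormedAddCommGroup H] [InnerProductSpace ℝ H] [CompleteSpace H]
  [MeasurableSpace H] [BorelSpace H]

/-- The mean `m = ∫ x dμ(x)`. -/
def mean (μ : Measure H) : H := ∫ x, x ∂μ

/-- The (centered) covariance operator: `⟪C x, y⟫ = ∫ ⟪x, z - m⟫ ⟪y, z - m⟫ dμ(z)`. -/
def cov (μ : Measure H) : H →L[ℝ] H :=
  InnerProductSpace.continuousLinearMapOfBilin (covarianceBilin μ)

/-- `C + γ I`, with `C` the covariance operator of `μ`. -/
def regCov (γ : ℝ) (μ : Measure H) : H →L[ℝ] H := cov μ + γ • 1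

/-- `C_{α,γ} = [(1-α)(C₀ + γ I)⁻¹ + α (C₁ + γ I)⁻¹]⁻¹`. -/
def interpCov (α γ : ℝ) (μ₀ μ₁ : Measure H) : H →L[ℝ] H :=
  Ring.inverse
    ((1 - α) • Ring.inverse (regCov γ μ₀) + α • Ring.inverse (regCov γ μ₁))

/-- `m_{α,γ} = C_{α,γ} [(1-α)(C₀ + γ I)⁻¹ m₀ + α (C₁ + γ I)⁻¹ m₁]`. -/
def interpMean (α γ : ℝ) (μ₀ μ₁ : Measure H) : H :=
  interpCov α γ μ₀ μ₁
    ((1 - α) • Ring.inverse (regCov γ μ₀) (mean μ₀)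
      + α • Ring.inverse (regCov γ μ₁) (mean μ₁))

/-- The regularized geometric Jensen–Shannon divergence of two Gaussian measures on `H`. Here
`posSqrt (Ring.inverse C)` is `C^{-1/2}`. -/
def regJS (α γ : ℝ) (μ₀ μ₁ : Measure H) : ℝ :=
  (1 - α) / 2 *
      ‖posSqrt (Ring.inverse (interpCov α γ μ₀ μ₁)) (mean μ₀ - interpMean α γ μ₀ μ₁)‖ ^ 2
    + α / 2 *
      ‖posSqrt (Ring.inverse (interpCov α γ μ₀ μ₁)) (mean μ₁ - interpMean α γ μ₀ μ₁)‖ ^ 2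
    + (1 - α) / 2 * logDetDiv (regCov γ μ₀) (interpCov α γ μ₀ μ₁)
    + α / 2 * logDetDiv (regCov γ μ₁) (interpCov α γ μ₀ μ₁)

end Gaussian

end RegJS

end

/-!
For operators `T = A + γ I` and `S = B + γ I` with the same scalar part, the Log-Det divergence is
`tr (S⁻¹ T - I) - log det (S⁻¹ T)`. Since `S⁻¹ T - I = S⁻¹ (T - S)` is similar to the self-adjoint
trace class operator `K = S^{-1/2} (T - S) S^{-1/2}`, whose eigenvalues `λₖ` exceed `-1`, it equals
`∑ₖ (λₖ - log (1 + λₖ))`. Every term is nonnegative and vanishes only for `λₖ = 0`, so the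
divergence is nonnegative and is zero exactly when `T = S`
(`logDetDiv_nonneg_and_eq_zero_iff`). Hence the Jensen–Shannon divergence is a sum of four
nonnegative terms; when it vanishes, both regularized covariances equal the interpolated one and
both means equal the interpolated mean, and a Gaussian measure is determined by its mean and
covariance.

The functional analysis behind this formula is as follows.

* Every positive operator has a positive square root (`exists_isPosSqrt`), by the power series of
  `√(1 - x)`, whose coefficients are Catalan numbers divided by powers of `4`.
* Trace class operators are handled through the span of products of two Hilbert–Schmidt operators,
  visibly a two-sided ideal. Its members are compact and trace class
  (`isTraceClass_of_mem_nuclear`), and in infinite dimensions it pins down the scalar part of an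
  extended trace class operator (`scalarPart_eq`).
* A compact self-adjoint operator has an orthonormal eigenbasis (`exists_eigenbasis`). In it the
  trace of a conjugate `G K G⁻¹` is the sum of the eigenvalues (`trace_mul_mul_eq_tsum`), and the
  algebraic multiplicities, which are invariant under conjugation (`algMult_conj`), are the
  dimensions of the real eigenspaces (`algMult_ofReal`, `algMult_of_im_ne_zero`), so that the
  Fredholm determinant is `∏ₖ (1 + λₖ)` (`fredholmDet_eq_exp_tsum`).
* The covariance of a Gaussian measure has finite trace (`cov_mem_nuclear`), and therefore the
  interpolated covariance differs from `γ I` by a trace class operator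
  (`interpCov_sub_mem_nuclear`).
-/

set_option linter.unusedSectionVars false

noncomputable section

namespace RegJS

open Finset.HasAntidiagonal (antidiagonal mem_antidiagonal)

/-! ### Square roots of positive operators -/

/-- The coefficients of `v(x) = (1 - √(1 - x)) / x = ∑ vₙ xⁿ`. -/
def sqrtCoeff (n : ℕ) : ℝ := catalan n / (2 * 4 ^ n)

lemma sqrtCoeff_nonneg (n : ℕ) : 0 ≤ sqrtCoeff n := by unfold sqrtCoeff; positivity

/-- The coefficient form of `v = (1 + x v²) / 2`. -/
lemma sqrtCoeff_succ (n : ℕ) :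
    sqrtCoeff (n + 1) = 1 / 2 * ∑ p ∈ antidiagonal n, sqrtCoeff p.1 * sqrtCoeff p.2 := by
  rw [sqrtCoeff, catalan_succ', Nat.cast_sum, Finset.sum_div, Finset.mul_sum]
  refine Finset.sum_congr rfl fun p hp => ?_
  obtain rfl := mem_antidiagonal.1 hp
  simp only [sqrtCoeff, Nat.cast_mul]
  field_simp
  ring

/-- The partial sums satisfy `s_{N+1} ≤ (1 + s_N²) / 2`, hence stay below `1`. -/
lemma sum_range_sqrtCoeff_le (N : ℕ) : ∑ n ∈ Finset.range N, sqrtCoeff n ≤ 1 := by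
  induction N with
  | zero => simp
  | succ N ih =>
    have h0 : 0 ≤ ∑ n ∈ Finset.range N, sqrtCoeff n :=
      Finset.sum_nonneg fun n _ => sqrtCoeff_nonneg n
    have h1 : ∑ n ∈ Finset.range N, ∑ p ∈ antidiagonal n, sqrtCoeff p.1 * sqrtCoeff p.2
        ≤ (∑ n ∈ Finset.range N, sqrtCoeff n) * ∑ n ∈ Finset.range N, sqrtCoeff n := by
      rw [Finset.sum_mul_sum, ← Finset.sum_product', Finset.sum_sigma']
      refine (Finset.sum_nbij (fun q => q.2) ?_ ?_ ?_ ?_).trans_le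
        (Finset.sum_le_sum_of_subset_of_nonneg (s := ((Finset.range N).sigma fun n =>
          antidiagonal n).image fun q => q.2) ?_ ?_)
      · intro q hq
        exact Finset.mem_image_of_mem _ hq
      · rintro ⟨n, p⟩ hp ⟨m, q⟩ hq (h : p = q)
        simp only [Finset.coe_sigma, Set.mem_sigma_iff, Finset.mem_coe,
          mem_antidiagonal] at hp hq
        subst h
        obtain rfl : n = m := hp.2.symm.trans hq.2
        rfl
      · intro p hp
        simpa using hp
      · intro q _
        rfl
      · intro p hp
        obtain ⟨⟨n, q⟩, hq, rfl⟩ := Finset.mem_image.1 hp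
        simp only [Finset.mem_sigma, Finset.mem_range, mem_antidiagonal,
          Finset.mem_product] at hq ⊢
        omega
      · intro p _ _
        exact mul_nonneg (sqrtCoeff_nonneg _) (sqrtCoeff_nonneg _)
    rw [Finset.sum_range_succ']
    simp only [sqrtCoeff_succ, ← Finset.mul_sum]
    have h2 : sqrtCoeff 0 = 1 / 2 := by simp [sqrtCoeff]
    rw [h2]
    nlinarith

lemma summable_sqrtCoeff : Summable sqrtCoeff :=
  summable_of_sum_range_le sqrtCoeff_nonneg sum_range_sqrtCoeff_le

lemma tsum_sqrtCoeff_le : ∑' n, sqrtCoeff n ≤ 1 :=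
  Real.tsum_le_of_sum_range_le sqrtCoeff_nonneg sum_range_sqrtCoeff_le

section

variable {H : Type*} [NormedAddCommGroup H] [InnerProductSpace ℝ H] [CompleteSpace H]

open ContinuousLinearMap

lemma isPositive_of_inner {A : H →L[ℝ] H} (hA : IsSelfAdjoint A) (h : ∀ x, 0 ≤ ⟪A x, x⟫) :
    A.IsPositive :=
  (isPositive_iff' A).2 ⟨hA, h⟩

lemma norm_pow_le_one {X : H →L[ℝ] H} (hX : ‖X‖ ≤ 1) (n : ℕ) : ‖X ^ n‖ ≤ 1 := by
  induction n with
  | zero => exact ContinuousLinearMap.norm_id_le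
  | succ n ih =>
    rw [pow_succ]
    exact (norm_mul_le _ _).trans (mul_le_one₀ ih (norm_nonneg _) hX)

/-- A self-adjoint contraction `X` gives the square root `1 - X v(X)` of `1 - X`. -/
lemma exists_isPosSqrt_one_sub {X : H →L[ℝ] H} (hX : IsSelfAdjoint X) (hX1 : ‖X‖ ≤ 1) :
    ∃ P, IsPosSqrt P (1 - X) := by
  have hterm (n : ℕ) : ‖sqrtCoeff n • X ^ n‖ ≤ sqrtCoeff n := by
    rw [norm_smul, Real.norm_of_nonneg (sqrtCoeff_nonneg n)]
    exact mul_le_of_le_one_right (sqrtCoeff_nonneg n) (norm_pow_le_one hX1 n)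
  have hn : Summable fun n => ‖sqrtCoeff n • X ^ n‖ :=
    Summable.of_nonneg_of_le (fun _ => norm_nonneg _) hterm summable_sqrtCoeff
  have hs : Summable fun n => sqrtCoeff n • X ^ n := hn.of_norm
  set V : H →L[ℝ] H := ∑' n, sqrtCoeff n • X ^ n with hV
  have hVn : ‖V‖ ≤ 1 :=
    (tsum_of_norm_bounded summable_sqrtCoeff.hasSum hterm).trans tsum_sqrtCoeff_le
  have hcomm : Commute X V :=
    Commute.tsum_right X fun n => ((Commute.refl X).pow_right n).smul_right _
  have hVV : V * V = ∑' n, (∑ p ∈ antidiagonal n, sqrtCoeff p.1 * sqrtCoeff p.2) • X ^ n := by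
    rw [hV, tsum_mul_tsum_eq_tsum_sum_antidiagonal_of_summable_norm hn hn]
    refine tsum_congr fun n => ?_
    rw [Finset.sum_smul]
    refine Finset.sum_congr rfl fun p hp => ?_
    rw [smul_mul_smul_comm, ← pow_add, mem_antidiagonal.1 hp]
  have hrec : V = (1 / 2 : ℝ) • (1 + X * (V * V)) := by
    have hs2 : Summable fun n =>
        (∑ p ∈ antidiagonal n, sqrtCoeff p.1 * sqrtCoeff p.2) • X ^ n := by
      have := (summable_norm_sum_mul_antidiagonal_of_summable_norm hn hn).of_norm
      refine this.congr fun n => ?_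
      rw [Finset.sum_smul]
      refine Finset.sum_congr rfl fun p hp => ?_
      rw [smul_mul_smul_comm, ← pow_add, mem_antidiagonal.1 hp]
    rw [hVV, hV, hs.tsum_eq_zero_add, ← hs2.tsum_mul_left, smul_add, ← tsum_const_smul'']
    congr 1
    · simp [sqrtCoeff]
    · refine tsum_congr fun n => ?_
      rw [sqrtCoeff_succ, mul_smul_comm, ← pow_succ', smul_smul]
  have hVsa : IsSelfAdjoint V := by
    rw [IsSelfAdjoint, hV, tsum_star]
    refine tsum_congr fun n => ?_
    rw [star_smul, star_pow, hX.star_eq, star_trivial]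
  have hsa : IsSelfAdjoint (1 - X * V) := by
    refine (IsSelfAdjoint.one _).sub ?_
    rw [IsSelfAdjoint, star_mul, hX.star_eq, hVsa.star_eq, hcomm.eq]
  refine ⟨1 - X * V, isPositive_of_inner hsa fun x => ?_, ?_⟩
  · have h1 : ‖(X * V) x‖ ≤ ‖x‖ := by
      refine ((X * V).le_opNorm x).trans (mul_le_of_le_one_left (norm_nonneg _) ?_)
      exact (norm_mul_le _ _).trans (mul_le_one₀ hX1 (norm_nonneg _) hVn)
    have h2 : ⟪(X * V) x, x⟫ ≤ ‖x‖ * ‖x‖ :=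
      (real_inner_le_norm _ _).trans (mul_le_mul_of_nonneg_right h1 (norm_nonneg _))
    rw [sub_apply, inner_sub_left, one_apply_eq_self, real_inner_self_eq_norm_mul_norm]
    linarith
  · have h2 : X * (V * V) = 2 • V - 1 := by
      conv_rhs => rw [hrec]
      rw [two_nsmul, ← add_smul]
      norm_num
    have h3 : X * V * (X * V) = X * (X * (V * V)) := by
      rw [mul_assoc, ← mul_assoc V X V, ← hcomm.eq, mul_assoc]
    rw [sub_mul, mul_sub, mul_sub, h3, h2]
    simp only [mul_one, one_mul, two_nsmul, mul_sub, mul_add]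
    abel

/-- Cauchy–Schwarz for the form of a positive operator. -/
lemma norm_apply_sq_le_of_isPositive {A : H →L[ℝ] H} (hA : A.IsPositive) (x : H) :
    ‖A x‖ ^ 2 ≤ ‖A‖ * ⟪A x, x⟫ := by
  rcases (norm_nonneg A).eq_or_lt with h | h
  · have : A = 0 := norm_eq_zero.1 h.symm
    simp [this]
  -- The form is nonnegative at `x - ‖A‖⁻¹ A x`.
  · have h1 := hA.inner_nonneg_left (x - ‖A‖⁻¹ • A x)
    have h2 : ⟪A (A x), A x⟫ ≤ ‖A‖ * ‖A x‖ ^ 2 := by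
      refine (real_inner_le_norm _ _).trans ?_
      have := mul_le_mul_of_nonneg_right (A.le_opNorm (A x)) (norm_nonneg (A x))
      nlinarith
    have h3 : ⟪A (A x), x⟫ = ‖A x‖ ^ 2 := by
      rw [hA.inner_left_eq_inner_right, real_inner_self_eq_norm_sq]
    simp only [map_sub, map_smul, inner_sub_left, inner_sub_right, real_inner_smul_left,
      real_inner_smul_right, h3, real_inner_self_eq_norm_sq] at h1
    have h4 : ‖A‖⁻¹ * (‖A‖⁻¹ * ⟪A (A x), A x⟫) ≤ ‖A‖⁻¹ * ‖A x‖ ^ 2 := by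
      refine mul_le_mul_of_nonneg_left ?_ (by positivity)
      rw [inv_mul_le_iff₀ h]
      exact h2
    have h5 : ‖A‖⁻¹ * ‖A x‖ ^ 2 ≤ ⟪A x, x⟫ := by linarith
    rwa [inv_mul_le_iff₀ h] at h5

/-- After rescaling, `1 - ‖A‖⁻¹ A` is a contraction. -/
theorem exists_isPosSqrt {A : H →L[ℝ] H} (hA : A.IsPositive) : ∃ P, IsPosSqrt P A := by
  rcases (norm_nonneg A).eq_or_lt with h | h
  · exact ⟨0, isPositive_zero, by rw [norm_eq_zero.1 h.symm, mul_zero]⟩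
  · set X : H →L[ℝ] H := 1 - ‖A‖⁻¹ • A with hXd
    have hX : IsSelfAdjoint X :=
      (IsSelfAdjoint.one _).sub ((IsSelfAdjoint.all ‖A‖⁻¹).smul hA.isSelfAdjoint)
    have hX1 : ‖X‖ ≤ 1 := by
      refine opNorm_le_bound _ zero_le_one fun x => ?_
      rw [one_mul]
      refine le_of_sq_le_sq ?_ (norm_nonneg _)
      have h1 := norm_apply_sq_le_of_isPositive hA x
      have h2 := hA.inner_nonneg_left x
      have h3 : ‖A‖⁻¹ * ‖A x‖ ^ 2 ≤ ⟪A x, x⟫ := by rwa [inv_mul_le_iff₀ h]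
      have h4 : ‖A‖⁻¹ * (‖A‖⁻¹ * ‖A x‖ ^ 2) ≤ ‖A‖⁻¹ * ⟪A x, x⟫ :=
        mul_le_mul_of_nonneg_left h3 (by positivity)
      have h5 : 0 ≤ ‖A‖⁻¹ * ⟪A x, x⟫ := by positivity
      have h6 : X x = x - ‖A‖⁻¹ • A x := by simp [hXd]
      rw [h6, norm_sub_sq_real, real_inner_smul_right, norm_smul,
        Real.norm_of_nonneg (by positivity), real_inner_comm, mul_pow]
      nlinarith
    obtain ⟨P, hP, hPP⟩ := exists_isPosSqrt_one_sub hX hX1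
    refine ⟨Real.sqrt ‖A‖ • P, hP.smul_of_nonneg (Real.sqrt_nonneg _), ?_⟩
    rw [smul_mul_smul_comm, hPP, Real.mul_self_sqrt h.le, hXd, sub_sub_cancel, smul_smul,
      mul_inv_cancel₀ h.ne', one_smul]

lemma posSqrt_spec {A : H →L[ℝ] H} (hA : A.IsPositive) : IsPosSqrt (posSqrt A) A := by
  have h := exists_isPosSqrt hA
  rw [posSqrt, dif_pos h]
  exact h.choose_spec

/-! ### Positive definite operators -/

/-- Positive definite operators: self-adjoint with a positive lower bound. -/
def IsPosDef (A : H →L[ℝ] H) : Prop :=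
  A.IsPositive ∧ ∃ c : ℝ, 0 < c ∧ ∀ x, c * ‖x‖ ^ 2 ≤ ⟪A x, x⟫

namespace IsPosDef

variable {A B : H →L[ℝ] H}

lemma isUnit (hA : IsPosDef A) : IsUnit A := by
  obtain ⟨-, c, hc, h⟩ := hA
  refine isUnit_of_forall_le_norm_inner_map A (c := ⟨c, hc.le⟩) hc fun x => ?_
  rw [mul_comm]
  exact (h x).trans (le_abs_self _)

lemma add (hA : IsPosDef A) (hB : IsPosDef B) : IsPosDef (A + B) := by
  obtain ⟨hA, c, hc, h⟩ := hA
  obtain ⟨hB, d, hd, h'⟩ := hB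
  refine ⟨hA.add hB, c + d, add_pos hc hd, fun x => ?_⟩
  rw [add_apply, inner_add_left, add_mul]
  exact add_le_add (h x) (h' x)

lemma smul (hA : IsPosDef A) {r : ℝ} (hr : 0 < r) : IsPosDef (r • A) := by
  obtain ⟨hA, c, hc, h⟩ := hA
  refine ⟨hA.smul_of_nonneg hr.le, r * c, mul_pos hr hc, fun x => ?_⟩
  rw [smul_apply, real_inner_smul_left, mul_assoc]
  exact mul_le_mul_of_nonneg_left (h x) hr.le

lemma add_smul_one (hA : A.IsPositive) {r : ℝ} (hr : 0 < r) : IsPosDef (A + r • 1) := by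
  refine ⟨hA.add (isPositive_one.smul_of_nonneg hr.le), r, hr, fun x => ?_⟩
  have := hA.inner_nonneg_left x
  simp only [add_apply, smul_apply, one_apply_eq_self, inner_add_left, real_inner_smul_left,
    real_inner_self_eq_norm_sq]
  linarith

lemma inverse (hA : IsPosDef A) : IsPosDef (Ring.inverse A) := by
  have hu := hA.isUnit
  obtain ⟨hA, c, hc, h⟩ := hA
  have hr (x : H) : A (Ring.inverse A x) = x := by
    rw [← mul_apply_eq_comp, Ring.mul_inverse_cancel _ hu, one_apply_eq_self]
  have hinner (x : H) : ⟪Ring.inverse A x, x⟫ = ⟪A (Ring.inverse A x), Ring.inverse A x⟫ := by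
    rw [hr, real_inner_comm]
  have hsa : IsSelfAdjoint (Ring.inverse A) := by
    rw [IsSelfAdjoint, ← Ring.inverse_star, hA.isSelfAdjoint.star_eq]
  refine ⟨isPositive_of_inner hsa fun x => ?_, c / (‖A‖ + 1) ^ 2, by positivity, fun x => ?_⟩
  · rw [hinner]
    exact hA.inner_nonneg_left _
  · rw [hinner]
    refine le_trans ?_ (h _)
    rw [div_mul_eq_mul_div, mul_div_assoc]
    refine mul_le_mul_of_nonneg_left ?_ hc.le
    rw [div_le_iff₀ (by positivity), ← mul_pow]
    refine pow_le_pow_left₀ (norm_nonneg _) ?_ 2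
    have h1 := A.le_opNorm (Ring.inverse A x)
    rw [hr] at h1
    nlinarith [norm_nonneg (Ring.inverse A x)]

end IsPosDef

end

section

variable {H : Type*} [NormedAddCommGroup H] [InnerProductSpace ℝ H] [CompleteSpace H]

open ContinuousLinearMap

/-! ### Hilbert–Schmidt operators -/

lemma hasSum_inner_sq {ι : Type*} (e : HilbertBasis ι ℝ H) (x : H) :
    HasSum (fun i => ⟪e i, x⟫ ^ 2) (‖x‖ ^ 2) := by
  rw [← real_inner_self_eq_norm_sq]
  refine (e.hasSum_inner_mul_inner x x).congr_fun fun i => ?_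
  rw [real_inner_comm x, sq]

/-- Both sums equal `∑ᵢⱼ ⟪f j, Q (e i)⟫²`. -/
lemma hasSum_norm_adjoint_sq {ι κ : Type*} (e : HilbertBasis ι ℝ H) (f : HilbertBasis κ ℝ H)
    {Q : H →L[ℝ] H} {s : ℝ} (h : HasSum (fun i => ‖Q (e i)‖ ^ 2) s) :
    HasSum (fun j => ‖adjoint Q (f j)‖ ^ 2) s := by
  have hrow (i : ι) := hasSum_inner_sq f (Q (e i))
  have hcol (j : κ) : HasSum (fun i => ⟪f j, Q (e i)⟫ ^ 2) (‖adjoint Q (f j)‖ ^ 2) := by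
    refine (hasSum_inner_sq e (adjoint Q (f j))).congr_fun fun i => ?_
    rw [adjoint_inner_right, real_inner_comm]
  have hs : Summable fun p : ι × κ => ⟪f p.2, Q (e p.1)⟫ ^ 2 := by
    refine (summable_prod_of_nonneg fun p => sq_nonneg _).2 ⟨fun i => (hrow i).summable, ?_⟩
    exact h.summable.congr fun i => (hrow i).tsum_eq.symm
  have h1 : HasSum (fun p : ι × κ => ⟪f p.2, Q (e p.1)⟫ ^ 2) s := by
    rw [← (hs.hasSum.prod_fiberwise hrow).unique h]
    exact hs.hasSum
  exact ((Equiv.prodComm κ ι).hasSum_iff.2 h1).prod_fiberwise hcol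

/-- Hilbert–Schmidt operators, `∑ ‖Q eᵢ‖² < ∞`. The fixed basis `onb H` is used; the choice does
not matter by `IsHilbertSchmidt.summable`. -/
def IsHilbertSchmidt (Q : H →L[ℝ] H) : Prop := Summable fun i => ‖Q (onb H i)‖ ^ 2

lemma IsHilbertSchmidt.of_summable_adjoint {ι : Type*} (e : HilbertBasis ι ℝ H) {Q : H →L[ℝ] H}
    (h : Summable fun i => ‖adjoint Q (e i)‖ ^ 2) : IsHilbertSchmidt Q := by
  have := (hasSum_norm_adjoint_sq e (onb H) h.hasSum).summable
  rwa [adjoint_adjoint] at this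

namespace IsHilbertSchmidt

variable {Q R : H →L[ℝ] H}

lemma adjoint (h : IsHilbertSchmidt Q) : IsHilbertSchmidt (adjoint Q) :=
  (hasSum_norm_adjoint_sq (onb H) (onb H) h.hasSum).summable

lemma summable {ι : Type*} (h : IsHilbertSchmidt Q) (e : HilbertBasis ι ℝ H) :
    Summable fun i => ‖Q (e i)‖ ^ 2 := by
  have := (hasSum_norm_adjoint_sq (onb H) e h.adjoint.hasSum).summable
  rwa [adjoint_adjoint] at this

lemma mul_left (h : IsHilbertSchmidt Q) (B : H →L[ℝ] H) : IsHilbertSchmidt (B * Q) := by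
  refine Summable.of_nonneg_of_le (fun _ => by positivity) (fun i => ?_)
    (Summable.mul_left (‖B‖ ^ 2) h)
  rw [← mul_pow]
  exact pow_le_pow_left₀ (norm_nonneg _) (B.le_opNorm _) 2

lemma mul_right (h : IsHilbertSchmidt Q) (B : H →L[ℝ] H) : IsHilbertSchmidt (Q * B) := by
  have := (h.adjoint.mul_left (ContinuousLinearMap.adjoint B)).adjoint
  rwa [← star_eq_adjoint, ← star_eq_adjoint, ← star_eq_adjoint, star_mul, star_star,
    star_star] at this

lemma smul (h : IsHilbertSchmidt Q) (r : ℝ) : IsHilbertSchmidt (r • Q) := by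
  have := h.mul_left (r • 1)
  rwa [smul_mul_assoc, one_mul] at this

lemma add (h : IsHilbertSchmidt Q) (h' : IsHilbertSchmidt R) : IsHilbertSchmidt (Q + R) := by
  refine Summable.of_nonneg_of_le (fun _ => by positivity) (fun i => ?_)
    ((Summable.add h h').mul_left 2)
  have h1 := norm_add_le (Q (onb H i)) (R (onb H i))
  have h2 := norm_nonneg (Q (onb H i) + R (onb H i))
  rw [add_apply]
  nlinarith [sq_nonneg (‖Q (onb H i)‖ - ‖R (onb H i)‖)]

/-- The finite rank operators `∑_{i ∈ F} eᵢ ⊗ Q* eᵢ` converge to `Q` in norm. -/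
lemma isCompactOperator (h : IsHilbertSchmidt Q) : IsCompactOperator Q := by
  set e := onb H
  set a : basisSet H → ℝ := fun i => ‖ContinuousLinearMap.adjoint Q (e i)‖ ^ 2 with ha
  have hs : Summable a := h.adjoint
  let R (F : Finset (basisSet H)) : H →L[ℝ] H :=
    ∑ i ∈ F, (innerSL ℝ (ContinuousLinearMap.adjoint Q (e i))).smulRight (e i)
  have hRx (F) (x : H) : R F x = ∑ i ∈ F, ⟪e i, Q x⟫ • e i := by
    simp only [R, sum_apply, smulRight_apply, innerSL_apply_apply, adjoint_inner_left]
  have hR (F) : IsCompactOperator (R F) := by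
    refine (compactOperator (RingHom.id ℝ) H H).sum_mem fun i _ => ?_
    have h1 : IsCompactOperator ((ContinuousLinearMap.id ℝ ℝ).smulRight (e i) : ℝ →L[ℝ] H) :=
      isCompactOperator_of_locallyCompactSpace_rng _
    exact h1.comp_clm (innerSL ℝ (ContinuousLinearMap.adjoint Q (e i)))
  have hnorm (F) : ‖R F - Q‖ ≤ Real.sqrt (∑' i, a i - ∑ i ∈ F, a i) := by
    refine opNorm_le_bound _ (Real.sqrt_nonneg _) fun x => ?_
    have hc : 0 ≤ ∑' i, a i - ∑ i ∈ F, a i :=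
      sub_nonneg.2 (hs.sum_le_tsum F fun i _ => sq_nonneg _)
    -- By Parseval; the coefficients of `(R F - Q) x` with index in `F` vanish.
    refine le_of_sq_le_sq ?_ (by positivity)
    rw [mul_pow, Real.sq_sqrt hc, ← (hasSum_inner_sq e ((R F - Q) x)).tsum_eq]
    refine Real.tsum_le_of_sum_le (fun _ => sq_nonneg _) fun G => ?_
    classical
    have hterm (j) : ⟪e j, (R F - Q) x⟫ ^ 2 ≤ if j ∈ F then 0 else a j * ‖x‖ ^ 2 := by
      rw [sub_apply, hRx, inner_sub_right]
      split_ifs with hj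
      · rw [e.orthonormal.inner_right_sum _ hj, sub_self, zero_pow two_ne_zero]
      · have h0 : ⟪e j, ∑ i ∈ F, ⟪e i, Q x⟫ • e i⟫ = 0 := by
          rw [inner_sum]
          refine Finset.sum_eq_zero fun i hi => ?_
          rw [real_inner_smul_right, e.orthonormal.inner_eq_zero (fun hji : j = i => hj (hji ▸ hi)),
            mul_zero]
        rw [h0, zero_sub, neg_sq, ← adjoint_inner_left, ← mul_pow, ← sq_abs]
        exact pow_le_pow_left₀ (abs_nonneg _) (abs_real_inner_le_norm _ _) 2
    refine (Finset.sum_le_sum fun j _ => hterm j).trans ?_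
    have h2 : ∑ j ∈ G, (if j ∈ F then 0 else a j * ‖x‖ ^ 2)
        = (∑ j ∈ G \ F, a j) * ‖x‖ ^ 2 := by
      rw [Finset.sum_mul, Finset.sdiff_eq_filter, Finset.sum_filter]
      refine Finset.sum_congr rfl fun j _ => ?_
      by_cases hj : j ∈ F <;> simp [hj]
    rw [h2]
    refine mul_le_mul_of_nonneg_right ?_ (sq_nonneg _)
    rw [le_sub_iff_add_le, ← Finset.sum_union Finset.sdiff_disjoint]
    exact hs.sum_le_tsum _ fun i _ => sq_nonneg _
  refine isCompactOperator_of_tendsto (l := Filter.atTop) (F := R) (f := Q) ?_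
    (Filter.Eventually.of_forall hR)
  rw [tendsto_iff_norm_sub_tendsto_zero]
  refine squeeze_zero (fun _ => norm_nonneg _) hnorm ?_
  have h3 : Filter.Tendsto (fun F => ∑' i, a i - ∑ i ∈ F, a i) Filter.atTop (nhds 0) := by
    simpa using (tendsto_const_nhds (x := ∑' i, a i)).sub hs.hasSum
  simpa using h3.sqrt

end IsHilbertSchmidt

/-! ### The trace ideal -/

variable (H) in
/-- The trace ideal, described as the span of the products of two Hilbert–Schmidt operators. -/
def nuclear : Submodule ℝ (H →L[ℝ] H) :=
  Submodule.span ℝ {A | ∃ X Y, IsHilbertSchmidt X ∧ IsHilbertSchmidt Y ∧ A = X * Y}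

variable {A B : H →L[ℝ] H}

lemma mul_mem_nuclear (hA : IsHilbertSchmidt A) (hB : IsHilbertSchmidt B) : A * B ∈ nuclear H :=
  Submodule.subset_span ⟨A, B, hA, hB, rfl⟩

lemma nuclear_mul_left (hA : A ∈ nuclear H) (B : H →L[ℝ] H) : B * A ∈ nuclear H := by
  induction hA using Submodule.span_induction with
  | mem A h =>
    obtain ⟨X, Y, hX, hY, rfl⟩ := h
    rw [← mul_assoc]
    exact mul_mem_nuclear (hX.mul_left B) hY
  | zero => rw [mul_zero]; exact zero_mem _
  | add A A' _ _ h h' => rw [mul_add]; exact add_mem h h'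
  | smul r A _ h => rw [mul_smul_comm]; exact Submodule.smul_mem _ r h

lemma nuclear_mul_right (hA : A ∈ nuclear H) (B : H →L[ℝ] H) : A * B ∈ nuclear H := by
  induction hA using Submodule.span_induction with
  | mem A h =>
    obtain ⟨X, Y, hX, hY, rfl⟩ := h
    rw [mul_assoc]
    exact mul_mem_nuclear hX (hY.mul_right B)
  | zero => rw [zero_mul]; exact zero_mem _
  | add A A' _ _ h h' => rw [add_mul]; exact add_mem h h'
  | smul r A _ h => rw [smul_mul_assoc]; exact Submodule.smul_mem _ r h

lemma isCompactOperator_of_mem_nuclear (hA : A ∈ nuclear H) : IsCompactOperator A := by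
  have : A ∈ compactOperator (RingHom.id ℝ) H H := by
    refine Submodule.span_le.2 ?_ hA
    rintro _ ⟨X, Y, hX, -, rfl⟩
    exact hX.isCompactOperator.comp_clm Y
  exact this

/-- For `A = X Y` the sum is at most `(‖X‖₂² + ‖Y‖₂²) / 2`, because `‖U X‖₂ ≤ ‖X‖₂`. -/
lemma exists_sum_inner_le_of_mem_nuclear {ι : Type*} (e : HilbertBasis ι ℝ H)
    (hA : A ∈ nuclear H) :
    ∃ M, ∀ U : H →L[ℝ] H, ‖U‖ ≤ 1 → ∀ F : Finset ι, ∑ i ∈ F, |⟪e i, U (A (e i))⟫| ≤ M := by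
  induction hA using Submodule.span_induction with
  | mem A h =>
    obtain ⟨X, Y, hX, hY, rfl⟩ := h
    refine ⟨1 / 2 * (∑' i, ‖X (e i)‖ ^ 2 + ∑' i, ‖Y (e i)‖ ^ 2), fun U hU F => ?_⟩
    have hUX := (hX.mul_left U).summable e
    have h1 := hasSum_norm_adjoint_sq e e hUX.hasSum
    have h2 : ∑' i, ‖(U * X) (e i)‖ ^ 2 ≤ ∑' i, ‖X (e i)‖ ^ 2 := by
      refine hUX.tsum_le_tsum (fun i => ?_) (hX.summable e)
      refine pow_le_pow_left₀ (norm_nonneg _) ?_ 2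
      exact (U.le_opNorm _).trans (mul_le_of_le_one_left (norm_nonneg _) hU)
    have h3 : ∑ i ∈ F, ‖adjoint (U * X) (e i)‖ ^ 2 ≤ ∑' i, ‖(U * X) (e i)‖ ^ 2 :=
      sum_le_hasSum F (fun _ _ => sq_nonneg _) h1
    have h4 : ∑ i ∈ F, ‖Y (e i)‖ ^ 2 ≤ ∑' i, ‖Y (e i)‖ ^ 2 :=
      (hY.summable e).sum_le_tsum F fun _ _ => sq_nonneg _
    have h5 (i : ι) : |⟪e i, U ((X * Y) (e i))⟫|
        ≤ 1 / 2 * (‖adjoint (U * X) (e i)‖ ^ 2 + ‖Y (e i)‖ ^ 2) := by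
      have : ⟪e i, U ((X * Y) (e i))⟫ = ⟪adjoint (U * X) (e i), Y (e i)⟫ := by
        rw [adjoint_inner_left]; rfl
      rw [this]
      refine (abs_real_inner_le_norm _ _).trans ?_
      nlinarith [sq_nonneg (‖adjoint (U * X) (e i)‖ - ‖Y (e i)‖)]
    refine (Finset.sum_le_sum fun i _ => h5 i).trans ?_
    rw [← Finset.mul_sum, Finset.sum_add_distrib]
    linarith
  | zero => exact ⟨0, fun U _ F => by simp⟩
  | add A B _ _ hA hB =>
    obtain ⟨M, hM⟩ := hA
    obtain ⟨N, hN⟩ := hB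
    refine ⟨M + N, fun U hU F => le_trans ?_ (add_le_add (hM U hU F) (hN U hU F))⟩
    rw [← Finset.sum_add_distrib]
    refine Finset.sum_le_sum fun i _ => ?_
    rw [add_apply, map_add, inner_add_right]
    exact abs_add_le _ _
  | smul r A _ hA =>
    obtain ⟨M, hM⟩ := hA
    refine ⟨|r| * M, fun U hU F => le_trans (le_of_eq ?_)
      (mul_le_mul_of_nonneg_left (hM U hU F) (abs_nonneg r))⟩
    rw [Finset.mul_sum]
    refine Finset.sum_congr rfl fun i _ => ?_
    rw [smul_apply, map_smul, real_inner_smul_right, abs_mul]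

lemma summable_inner_of_mem_nuclear {ι : Type*} (e : HilbertBasis ι ℝ H) (hA : A ∈ nuclear H) :
    Summable fun i => ⟪e i, A (e i)⟫ := by
  obtain ⟨M, hM⟩ := exists_sum_inner_le_of_mem_nuclear e hA
  have h1 : ‖(1 : H →L[ℝ] H)‖ ≤ 1 := norm_id_le
  exact (summable_of_sum_le (fun _ => abs_nonneg _) fun F => hM 1 h1 F).of_abs

/-- With `P = |A|`, the contractions `U_ε = (P + ε)⁻¹ A*` satisfy `U_ε A = P - ε (P + ε)⁻¹ P`, so
that they stand in for the partial isometry of the polar decomposition. -/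
lemma isTraceClass_of_mem_nuclear (hA : A ∈ nuclear H) : IsTraceClass A := by
  obtain ⟨P, hP, hPP⟩ : ∃ P, IsPosSqrt P (adjoint A * A) :=
    exists_isPosSqrt (isPositive_adjoint_comp_self A)
  refine ⟨P, ⟨hP, hPP⟩, basisSet H, onb H, ?_⟩
  obtain ⟨M, hM⟩ := exists_sum_inner_le_of_mem_nuclear (onb H) hA
  set e := onb H
  have hnormP (x : H) : ‖A x‖ = ‖P x‖ := by
    rw [← sq_eq_sq₀ (norm_nonneg _) (norm_nonneg _), ← real_inner_self_eq_norm_sq,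
      ← real_inner_self_eq_norm_sq, ← adjoint_inner_left, ← hP.inner_left_eq_inner_right]
    exact congrArg (fun T : H →L[ℝ] H => ⟪T x, x⟫) hPP.symm
  refine summable_of_sum_le (c := M) (fun i => hP.inner_nonneg_right _) fun F => ?_
  refine le_of_forall_pos_le_add fun δ hδ => ?_
  -- Each of the terms in `F` costs at most `ε`, in total less than `δ`.
  set ε : ℝ := δ / (F.card + 1) with hε
  have hε0 : 0 < ε := by positivity
  have hD := IsPosDef.add_smul_one hP hε0
  have hDu := hD.isUnit
  set D : H →L[ℝ] H := P + ε • 1 with hDdef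
  set N := Ring.inverse D with hN
  have hDN : D * N = 1 := Ring.mul_inverse_cancel _ hDu
  have hND : N * D = 1 := Ring.inverse_mul_cancel _ hDu
  have hPD : P * D = D * P := by simp [hDdef, mul_add, add_mul]
  have hNP : N * P = P * N := by
    calc N * P = N * (P * (D * N)) := by rw [hDN, mul_one]
      _ = N * (D * P) * N := by rw [← hPD, mul_assoc, mul_assoc]
      _ = P * N := by rw [← mul_assoc, hND, one_mul]
  have hPN (x : H) : ‖P (N x)‖ ≤ ‖x‖ := by
    have hx : x = P (N x) + ε • N x := by
      have := congrArg (fun T : H →L[ℝ] H => T x) hDN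
      simpa [hDdef] using this.symm
    have h1 := hP.inner_nonneg_left (N x)
    refine le_of_sq_le_sq ?_ (norm_nonneg _)
    conv_rhs => rw [hx, norm_add_sq_real, real_inner_smul_right]
    have h2 : 0 ≤ ε * ⟪P (N x), N x⟫ := mul_nonneg hε0.le h1
    nlinarith [sq_nonneg ‖ε • N x‖]
  have hU : ‖N * adjoint A‖ ≤ 1 := by
    have hNs : adjoint N = N := hD.inverse.1.isSelfAdjoint
    have h1 : adjoint (N * adjoint A) = A * N := by
      rw [← star_eq_adjoint, star_mul, star_eq_adjoint, star_eq_adjoint, adjoint_adjoint, hNs]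
    rw [← LinearIsometryEquiv.norm_map adjoint (N * adjoint A), h1]
    refine opNorm_le_bound _ zero_le_one fun x => ?_
    rw [one_mul, mul_apply_eq_comp, hnormP]
    exact hPN x
  have hkey : P = N * adjoint A * A + ε • (P * N) := by
    rw [mul_assoc, ← hPP, ← hNP, ← smul_mul_assoc]
    calc P = N * D * P := by rw [hND, one_mul]
      _ = _ := by rw [hDdef, mul_add, add_mul, mul_smul_comm, mul_one, mul_assoc]
  have hterm (i) : ⟪e i, P (e i)⟫ ≤ |⟪e i, (N * adjoint A) (A (e i))⟫| + ε := by
    have h1 : ⟪e i, P (e i)⟫ = ⟪e i, (N * adjoint A) (A (e i))⟫ + ε * ⟪e i, P (N (e i))⟫ := by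
      conv_lhs => rw [hkey]
      rw [add_apply, inner_add_right, smul_apply, real_inner_smul_right]
      rfl
    have h2 : ⟪e i, P (N (e i))⟫ ≤ 1 := by
      have h3 := (real_inner_le_norm (e i) (P (N (e i)))).trans
        (mul_le_mul_of_nonneg_left (hPN (e i)) (norm_nonneg _))
      rwa [e.orthonormal.1 i, one_mul] at h3
    rw [h1]
    exact add_le_add (le_abs_self _) (mul_le_of_le_one_right hε0.le h2)
  refine (Finset.sum_le_sum fun i _ => hterm i).trans ?_
  rw [Finset.sum_add_distrib]
  refine add_le_add (hM _ hU F) ?_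
  rw [Finset.sum_const, nsmul_eq_mul, hε, mul_div_assoc', div_le_iff₀ (Nat.cast_add_one_pos _)]
  nlinarith

lemma IsTraceClass.isHilbertSchmidt (hA : IsTraceClass A) : IsHilbertSchmidt A := by
  obtain ⟨P, ⟨hP, hPP⟩, w, e, hs⟩ := hA
  obtain ⟨Q, hQ, hQQ⟩ := exists_isPosSqrt hP
  have hQs : adjoint Q = Q := hQ.isSelfAdjoint
  have hQ2 : IsHilbertSchmidt Q := by
    refine IsHilbertSchmidt.of_summable_adjoint e (hs.congr fun i => ?_)
    rw [hQs, ← real_inner_self_eq_norm_sq, hQ.inner_left_eq_inner_right, ← hQQ]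
    rfl
  have hP2 : IsHilbertSchmidt P := hQQ ▸ hQ2.mul_left Q
  refine Summable.congr hP2 fun i => ?_
  rw [← real_inner_self_eq_norm_sq, ← real_inner_self_eq_norm_sq,
    ← hP.inner_left_eq_inner_right, ← adjoint_inner_left A]
  exact congrArg (fun T : H →L[ℝ] H => ⟪T (onb H i), onb H i⟫) hPP

lemma infinite_basisSet (hdim : ¬ FiniteDimensional ℝ H) : Infinite (basisSet H) := by
  by_contra hfin
  rw [not_infinite_iff_finite] at hfin
  have := Fintype.ofFinite (basisSet H)
  exact hdim (onb H).toOrthonormalBasis.toBasis.finiteDimensional_of_finite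

lemma eq_zero_of_isHilbertSchmidt_smul_one (hdim : ¬ FiniteDimensional ℝ H) {c : ℝ}
    (h : IsHilbertSchmidt (c • (1 : H →L[ℝ] H))) : c = 0 := by
  have := infinite_basisSet hdim
  have h1 : Summable fun _ : basisSet H => c ^ 2 := by
    refine Summable.congr h fun i => ?_
    rw [smul_apply, one_apply_eq_self, norm_smul, (onb H).orthonormal.1 i, mul_one,
      Real.norm_eq_abs, sq_abs]
  simpa using (summable_const_iff _).1 h1

/-- In infinite dimensions the scalar part is well defined: a nonzero multiple of the identity is
not Hilbert–Schmidt. -/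
lemma scalarPart_eq (hdim : ¬ FiniteDimensional ℝ H) {T : H →L[ℝ] H} {c : ℝ}
    (h : T - c • 1 ∈ nuclear H) : scalarPart T = c := by
  have h1 := isTraceClass_of_mem_nuclear h
  have hex : IsExtTraceClass T := ⟨c, h1⟩
  have h2 : IsTraceClass (T - scalarPart T • 1) := by
    rw [scalarPart, dif_pos hex]
    exact hex.choose_spec
  have h3 := h1.isHilbertSchmidt.add (h2.isHilbertSchmidt.smul (-1))
  have h4 : T - c • 1 + (-1 : ℝ) • (T - scalarPart T • 1)
      = (scalarPart T - c) • (1 : H →L[ℝ] H) := by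
    rw [sub_smul, neg_one_smul]
    abel
  rw [h4] at h3
  exact sub_eq_zero.1 (eq_zero_of_isHilbertSchmidt_smul_one hdim h3)

/-- A positive operator with finite trace is the square of its Hilbert–Schmidt square root. -/
lemma mem_nuclear_of_isPositive (hA : A.IsPositive)
    (h : Summable fun i => ⟪onb H i, A (onb H i)⟫) : A ∈ nuclear H := by
  obtain ⟨Q, hQ, hQQ⟩ := exists_isPosSqrt hA
  have hQ2 : IsHilbertSchmidt Q := by
    refine h.congr fun i => ?_
    rw [← real_inner_self_eq_norm_sq, hQ.inner_left_eq_inner_right, ← hQQ]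
    rfl
  exact hQQ ▸ mul_mem_nuclear hQ2 hQ2

end

section

variable {H : Type*} [NormedAddCommGroup H] [InnerProductSpace ℝ H] [CompleteSpace H]

open ContinuousLinearMap Module.End

/-! ### Eigenbases of compact self-adjoint operators -/

instance completeSpace_eigenspace (K : H →L[ℝ] H) (x : ℝ) :
    CompleteSpace (eigenspace (K : H →ₗ[ℝ] H) x) := by
  have h : (eigenspace (K : H →ₗ[ℝ] H) x : Set H) = (K - x • 1).ker := by
    ext v
    simp [sub_eq_zero]
  have h2 : IsComplete (eigenspace (K : H →ₗ[ℝ] H) x : Set H) := by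
    rw [h]
    exact ContinuousLinearMap.isComplete_ker _
  exact h2.completeSpace_coe

/-- The index set of an orthonormal eigenbasis of `K`: an eigenvalue together with a member of an
orthonormal basis of its eigenspace. -/
abbrev EigenIndex (K : H →L[ℝ] H) : Type _ :=
  Σ x : ℝ, basisSet (eigenspace (K : H →ₗ[ℝ] H) x)

theorem exists_eigenbasis {K : H →L[ℝ] H} (hK : IsCompactOperator K) (hs : IsSelfAdjoint K) :
    ∃ b : HilbertBasis (EigenIndex K) ℝ H, ∀ i, K (b i) = i.1 • b i := by
  have hsym : (K : H →ₗ[ℝ] H).IsSymmetric := hs.isSymmetric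
  let v : EigenIndex K → H := fun i => (onb (eigenspace (K : H →ₗ[ℝ] H) i.1) i.2 : H)
  have hv : Orthonormal ℝ v :=
    hsym.orthogonalFamily_eigenspaces.orthonormal_sigma_orthonormal fun x =>
      (onb (eigenspace (K : H →ₗ[ℝ] H) x)).orthonormal
  have hbot : (Submodule.span ℝ (Set.range v))ᗮ = ⊥ := by
    rw [eq_bot_iff, ← orthogonalComplement_iSup_eigenspaces_eq_bot hK hsym]
    intro y hy
    rw [Submodule.mem_orthogonal'] at hy ⊢
    have h1 : (⨆ x, eigenspace (K : H →ₗ[ℝ] H) x) ≤ (innerSL ℝ y).ker := by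
      refine iSup_le fun x u hu => ?_
      set E := eigenspace (K : H →ₗ[ℝ] H) x
      have h2 := ((onb E).hasSum_repr ⟨u, hu⟩).mapL ((innerSL ℝ y).comp E.subtypeL)
      have h3 (i) : ((innerSL ℝ y).comp E.subtypeL) ((onb E).repr ⟨u, hu⟩ i • onb E i) = 0 := by
        rw [map_smul]
        have h4 : ⟪y, v ⟨x, i⟩⟫ = 0 := hy _ (Submodule.subset_span ⟨⟨x, i⟩, rfl⟩)
        have h5 : ((innerSL ℝ y).comp E.subtypeL) (onb E i) = ⟪y, v ⟨x, i⟩⟫ := rfl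
        rw [h5, h4, smul_zero]
      simp only [h3] at h2
      exact h2.unique hasSum_zero
    intro u hu
    exact h1 hu
  refine ⟨HilbertBasis.mkOfOrthogonalEqBot hv hbot, fun i => ?_⟩
  rw [HilbertBasis.coe_mkOfOrthogonalEqBot]
  exact mem_eigenspace_iff.1 (onb (eigenspace (K : H →ₗ[ℝ] H) i.1) i.2).2

/-- The diagonal matrix entries of `G K R` in a basis are double series over the eigenbasis of `K`
and sum to `∑ₖ λₖ ⟪R* bₖ, G bₖ⟫`. -/
lemma trace_mul_mul_eq_tsum {ι : Type*} (b : HilbertBasis ι ℝ H) {l : ι → ℝ} {K G R : H →L[ℝ] H}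
    (hs : IsSelfAdjoint K) (hb : ∀ i, K (b i) = l i • b i) (hl : Summable fun i => |l i|)
    (hRG : R * G = 1) : trace (G * K * R) = ∑' i, l i := by
  set e := onb H
  let t : basisSet H × ι → ℝ := fun p =>
    l p.2 * (⟪adjoint R (b p.2), e p.1⟫ * ⟪e p.1, G (b p.2)⟫)
  have hcol (k : ι) : HasSum (fun j => t (j, k)) (l k) := by
    have h := (e.hasSum_inner_mul_inner (adjoint R (b k)) (G (b k))).mul_left (l k)
    have h1 : ⟪adjoint R (b k), G (b k)⟫ = 1 := by
      have h2 : R (G (b k)) = b k := congrArg (fun T : H →L[ℝ] H => T (b k)) hRG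
      rw [adjoint_inner_left, h2, real_inner_self_eq_norm_sq, b.orthonormal.1 k, one_pow]
    rwa [h1, mul_one] at h
  have hrow (j : basisSet H) : HasSum (fun k => t (j, k)) ⟪e j, (G * K * R) (e j)⟫ := by
    have h := b.hasSum_inner_mul_inner (K (adjoint G (e j))) (R (e j))
    have h1 : ⟪K (adjoint G (e j)), R (e j)⟫ = ⟪e j, (G * K * R) (e j)⟫ := by
      have h2 : ⟪K (adjoint G (e j)), R (e j)⟫ = ⟪adjoint G (e j), K (R (e j))⟫ :=
        hs.isSymmetric _ _
      rw [h2, adjoint_inner_left]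
      rfl
    rw [h1] at h
    refine h.congr_fun fun k => ?_
    have h3 : ⟪K (adjoint G (e j)), b k⟫ = ⟪adjoint G (e j), K (b k)⟫ := hs.isSymmetric _ _
    rw [h3, hb, real_inner_smul_right, adjoint_inner_left, ← adjoint_inner_left R, mul_assoc]
    ring
  -- Absolute convergence: bound the product of the two coefficients by half the sum of squares.
  have hsum : Summable t := by
    let s : ι × basisSet H → ℝ := fun p =>
      |l p.1| * (1 / 2 * (⟪e p.2, adjoint R (b p.1)⟫ ^ 2 + ⟪e p.2, G (b p.1)⟫ ^ 2))
    have hs0 (p) : 0 ≤ s p := by positivity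
    have hsk (k : ι) : HasSum (fun j => s (k, j))
        (|l k| * (1 / 2 * (‖adjoint R (b k)‖ ^ 2 + ‖G (b k)‖ ^ 2))) :=
      (((hasSum_inner_sq e _).add (hasSum_inner_sq e _)).mul_left _).mul_left _
    have hs1 : Summable s := by
      refine (summable_prod_of_nonneg hs0).2 ⟨fun k => (hsk k).summable, ?_⟩
      refine Summable.of_nonneg_of_le (fun k => tsum_nonneg fun j => hs0 _) (fun k => ?_)
        (hl.mul_right (1 / 2 * (‖adjoint R‖ ^ 2 + ‖G‖ ^ 2)))
      rw [(hsk k).tsum_eq]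
      have hle (T : H →L[ℝ] H) : ‖T (b k)‖ ^ 2 ≤ ‖T‖ ^ 2 := by
        refine pow_le_pow_left₀ (norm_nonneg _) ?_ 2
        simpa [b.orthonormal.1 k] using T.le_opNorm (b k)
      have := hle (adjoint R)
      have := hle G
      gcongr
    have hs2 := (Equiv.prodComm (basisSet H) ι).summable_iff.2 hs1
    refine Summable.of_norm_bounded hs2 fun p => ?_
    rw [Real.norm_eq_abs, abs_mul]
    refine mul_le_mul_of_nonneg_left ?_ (abs_nonneg _)
    change _ ≤ 1 / 2 * (⟪e p.1, adjoint R (b p.2)⟫ ^ 2 + ⟪e p.1, G (b p.2)⟫ ^ 2)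
    rw [real_inner_comm (e p.1), abs_le]
    constructor <;> nlinarith [sq_nonneg (⟪e p.1, adjoint R (b p.2)⟫ - ⟪e p.1, G (b p.2)⟫),
      sq_nonneg (⟪e p.1, adjoint R (b p.2)⟫ + ⟪e p.1, G (b p.2)⟫)]
  have h1 := hsum.hasSum.prod_fiberwise hrow
  have h2 := ((Equiv.prodComm ι (basisSet H)).hasSum_iff.2 hsum.hasSum).prod_fiberwise hcol
  exact h1.tsum_eq.trans h2.tsum_eq.symm

/-! ### Algebraic multiplicities and the Fredholm determinant -/

lemma finrank_maxGenEigenspace_of_comp_eq {V : Type*} [AddCommGroup V] [Module ℂ V]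
    {f g : Module.End ℂ V} (E : V ≃ₗ[ℂ] V) (h : f ∘ₗ E.toLinearMap = E.toLinearMap ∘ₗ g) (z : ℂ) :
    Module.finrank ℂ (maxGenEigenspace f z) = Module.finrank ℂ (maxGenEigenspace g z) := by
  have h1 : (f - z • 1) ∘ₗ E.toLinearMap = E.toLinearMap ∘ₗ (g - z • 1) := by
    rw [LinearMap.sub_comp, LinearMap.comp_sub, h]
    ext v
    simp
  have h2 : maxGenEigenspace f z = (maxGenEigenspace g z).map E.toLinearMap := by
    ext v
    obtain ⟨w, rfl⟩ := E.surjective v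
    rw [Submodule.mem_map_equiv]
    simp only [LinearEquiv.symm_apply_apply, mem_maxGenEigenspace]
    refine exists_congr fun k => ?_
    have h3 := LinearMap.congr_fun (commute_pow_left_of_commute h1 k) w
    simp only [LinearMap.comp_apply, LinearEquiv.coe_coe] at h3
    rw [h3, LinearEquiv.map_eq_zero_iff]
  rw [h2]
  exact LinearEquiv.finrank_map_eq E _

lemma algMult_conj {K G R : H →L[ℝ] H} (hRG : R * G = 1) (hGR : G * R = 1) (z : ℂ) :
    algMult (G * K * R) z = algMult K z := by
  let g : H ≃ₗ[ℝ] H := LinearEquiv.ofLinearMap (G : H →ₗ[ℝ] H) (R : H →ₗ[ℝ] H)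
    (congrArg (fun T : H →L[ℝ] H => (T : H →ₗ[ℝ] H)) hGR)
    (congrArg (fun T : H →L[ℝ] H => (T : H →ₗ[ℝ] H)) hRG)
  refine finrank_maxGenEigenspace_of_comp_eq (g.baseChange ℝ ℂ H H) ?_ z
  have h1 : (g.baseChange ℝ ℂ H H).toLinearMap = (G : H →ₗ[ℝ] H).baseChange ℂ := rfl
  rw [h1, ← LinearMap.baseChange_comp, ← LinearMap.baseChange_comp]
  congr 1
  have h2 : G * K * R * G = G * K := by rw [mul_assoc, hRG, mul_one]
  exact congrArg (fun T : H →L[ℝ] H => (T : H →ₗ[ℝ] H)) h2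

lemma fredholmDet_conj {K G R : H →L[ℝ] H} (hRG : R * G = 1) (hGR : G * R = 1) :
    fredholmDet (G * K * R) = fredholmDet K := by
  simp only [fredholmDet, algMult_conj hRG hGR]

lemma baseChange_sub_smul_one (k : Module.End ℝ H) (x : ℝ) :
    k.baseChange ℂ - (x : ℂ) • 1 = (k - x • 1).baseChange ℂ := by
  rw [LinearMap.baseChange_sub, LinearMap.baseChange_smul, LinearMap.baseChange_one]
  rfl

/-- Complexification is flat, so it commutes with kernels, and the generalized eigenvectors of a
symmetric operator are eigenvectors. -/
lemma algMult_ofReal {K : H →L[ℝ] H} (hs : IsSelfAdjoint K) (x : ℝ) :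
    algMult K x = Module.finrank ℝ (eigenspace (K : H →ₗ[ℝ] H) x) := by
  set k : Module.End ℝ H := (K : H →ₗ[ℝ] H)
  have hsym : k.IsSymmetric := hs.isSymmetric
  have hL := baseChange_sub_smul_one k x
  have h : maxGenEigenspace (k.baseChange ℂ) (x : ℂ) = (eigenspace k x).baseChange ℂ := by
    refine le_antisymm (fun v hv => ?_) ?_
    · obtain ⟨n, hn⟩ := (mem_maxGenEigenspace _ _ _).1 hv
      rw [hL, ← LinearMap.baseChange_pow] at hn
      have hex := Module.Flat.lTensor_exact (R := ℝ) ℂ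
        (LinearMap.exact_subtype_ker_map ((k - x • 1) ^ n))
      obtain ⟨w, hw⟩ := (hex v).1 hn
      have h1 : v ∈ (LinearMap.ker ((k - x • 1) ^ n)).baseChange ℂ := ⟨w, hw⟩
      refine Submodule.baseChange_mono (A := ℂ) ?_ h1
      rw [← hsym.isFinitelySemisimple.maxGenEigenspace_eq_eigenspace]
      exact fun u hu => (mem_maxGenEigenspace _ _ _).2 ⟨n, hu⟩
    · rw [Submodule.baseChange_eq_span, Submodule.span_le]
      rintro _ ⟨u, hu, rfl⟩
      refine (mem_maxGenEigenspace _ _ _).2 ⟨1, ?_⟩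
      rw [hL, pow_one]
      have h2 : (k - x • 1) u = 0 := by
        simpa [sub_eq_zero] using mem_eigenspace_iff.1 hu
      simp only [TensorProduct.mk_apply, LinearMap.baseChange_tmul, h2, TensorProduct.tmul_zero]
  rw [algMult, h, ← (Submodule.toBaseChange.toLinearEquiv ℂ _).finrank_eq,
    Module.finrank_baseChange]

/-- For `z = a + b i` with `b ≠ 0`, the operator `(K - z̄) (K - z)` is the complexification of the
injective operator `(K - a)² + b²`. -/
lemma algMult_of_im_ne_zero {K : H →L[ℝ] H} (hs : IsSelfAdjoint K) {z : ℂ} (hz : z.im ≠ 0) :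
    algMult K z = 0 := by
  set k : Module.End ℝ H := (K : H →ₗ[ℝ] H)
  have hsym : k.IsSymmetric := hs.isSymmetric
  set q : Module.End ℝ H := (k - z.re • 1) * (k - z.re • 1) + (z.im ^ 2) • 1 with hq
  have hinj : Function.Injective q := by
    rw [← LinearMap.ker_eq_bot, LinearMap.ker_eq_bot']
    intro u hu
    have h1 : ⟪q u, u⟫ = ‖(k - z.re • 1) u‖ ^ 2 + z.im ^ 2 * ‖u‖ ^ 2 := by
      have h2 : (k - z.re • 1).IsSymmetric :=
        hsym.sub (LinearMap.IsSymmetric.id.smul (by simp))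
      rw [hq, LinearMap.add_apply, inner_add_left, Module.End.mul_apply, h2,
        real_inner_self_eq_norm_sq, LinearMap.smul_apply, Module.End.one_apply,
        real_inner_smul_left, real_inner_self_eq_norm_sq]
    rw [hu, inner_zero_left] at h1
    have h3 : 0 < z.im ^ 2 := by positivity
    have h4 : ‖u‖ ^ 2 = 0 := by nlinarith [sq_nonneg ‖(k - z.re • 1) u‖, sq_nonneg ‖u‖]
    simpa using h4
  have hfac : (k.baseChange ℂ - (starRingEnd ℂ z) • 1) * (k.baseChange ℂ - z • 1)
      = q.baseChange ℂ := by
    have h1 : q.baseChange ℂ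
        = (k.baseChange ℂ - (z.re : ℂ) • 1) * (k.baseChange ℂ - (z.re : ℂ) • 1)
          + ((z.im ^ 2 : ℝ) : ℂ) • 1 := by
      rw [hq, baseChange_sub_smul_one, LinearMap.baseChange_add, LinearMap.baseChange_mul,
        LinearMap.baseChange_smul, LinearMap.baseChange_one]
      rfl
    have h2 : starRingEnd ℂ z = 2 * z.re - z := by
      apply Complex.ext <;> simp; ring
    have h3 : ((z.im ^ 2 : ℝ) : ℂ) = (2 * z.re - z) * z - z.re ^ 2 := by
      rw [← h2, ← Complex.normSq_eq_conj_mul_self, Complex.normSq_apply]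
      push_cast
      ring
    rw [h1, h2, h3]
    simp only [mul_sub, sub_mul, mul_smul_comm, smul_mul_assoc, mul_one, one_mul]
    module
  have hinj2 : Function.Injective (k.baseChange ℂ - z • (1 : Module.End ℂ (ℂ ⊗[ℝ] H))) := by
    have h1 : Function.Injective (q.baseChange ℂ) :=
      Module.Flat.lTensor_preserves_injective_linearMap q hinj
    rw [← hfac, Module.End.coe_mul] at h1
    exact Function.Injective.of_comp h1
  have h : maxGenEigenspace (k.baseChange ℂ) z = ⊥ := by
    rw [eq_bot_iff]
    intro v hv
    obtain ⟨n, hn⟩ := (mem_maxGenEigenspace _ _ _).1 hv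
    rw [Module.End.coe_pow] at hn
    exact hinj2.iterate n (hn.trans
      (iterate_map_zero (k.baseChange ℂ - z • (1 : Module.End ℂ (ℂ ⊗[ℝ] H))) n).symm)
  rw [algMult, h, finrank_bot]

/-- Grouping the eigenbasis by eigenvalue turns the product over the eigenbasis into the product
over all complex numbers with multiplicities. -/
lemma fredholmDet_eq_exp_tsum {K : H →L[ℝ] H} (hK : IsCompactOperator K) (hs : IsSelfAdjoint K)
    (hpos : ∀ i : EigenIndex K, 0 < 1 + i.1) (hl : Summable fun i : EigenIndex K => i.1) :
    fredholmDet K = Real.exp (∑' i : EigenIndex K, Real.log (1 + i.1)) := by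
  set P := Real.exp (∑' i : EigenIndex K, Real.log (1 + i.1))
  have h1 : HasProd (fun i : EigenIndex K => 1 + i.1) P :=
    Real.hasProd_of_hasSum_log hpos (Real.summable_log_one_add_of_summable hl).hasSum
  have h2 : HasProd (fun i : EigenIndex K => (1 + i.1 : ℂ)) (P : ℂ) := by
    have := h1.map Complex.ofRealHom Complex.continuous_ofReal
    refine this.congr_fun fun i => ?_
    simp
  have h3 : HasProd (fun x : ℝ => (1 + x : ℂ) ^ algMult K x) (P : ℂ) := by
    refine h2.sigma fun x => ?_
    rw [algMult_ofReal hs]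
    rcases eq_or_ne x 0 with rfl | hx
    · simp
    · set E := eigenspace (K : H →ₗ[ℝ] H) x
      have : FiniteDimensional ℝ E := finite_dimensional_eigenspace hK x hx
      have hfin : Finite (basisSet E) := (onb E).orthonormal.linearIndependent.finite
      have := Fintype.ofFinite (basisSet E)
      have h4 := hasProd_fintype (fun _ : basisSet E => (1 + x : ℂ))
      rwa [Finset.prod_const, Finset.card_univ,
        ← Module.finrank_eq_card_basis (onb E).toOrthonormalBasis.toBasis] at h4
  have h5 : HasProd (fun z : ℂ => (1 + z) ^ algMult K z) (P : ℂ) := by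
    refine (Complex.ofReal_injective.hasProd_iff fun z hz => ?_).1 h3
    rw [algMult_of_im_ne_zero hs, pow_zero]
    intro him
    exact hz ⟨z.re, Complex.ext rfl him.symm⟩
  rw [fredholmDet, h5.tprod_eq, Complex.ofReal_re]

end

section

variable {H : Type*} [NormedAddCommGroup H] [InnerProductSpace ℝ H] [CompleteSpace H]

open ContinuousLinearMap

/-! ### The Log-Det divergence -/

lemma logDetDiv_eq_trace_sub_log (hdim : ¬ FiniteDimensional ℝ H) {S T : H →L[ℝ] H}
    (hS : IsPosDef S) {γ : ℝ} (hγ : γ ≠ 0) (hSγ : S - γ • 1 ∈ nuclear H)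
    (hTγ : T - γ • 1 ∈ nuclear H) :
    logDetDiv T S = trace (Ring.inverse S * (T - S))
      - Real.log (fredholmDet (Ring.inverse S * (T - S))) := by
  set A := Ring.inverse S * (T - S) with hA
  have hAeq : Ring.inverse S * T - 1 = A := by
    rw [hA, mul_sub, Ring.inverse_mul_cancel _ hS.isUnit]
  have hAn : A ∈ nuclear H := by
    have h1 := sub_mem hTγ hSγ
    rw [sub_sub_sub_cancel_right] at h1
    exact nuclear_mul_left h1 _
  have h0 : scalarPart A = 0 := scalarPart_eq hdim (by simpa using hAn)
  have h1 : scalarPart (Ring.inverse S * T) = 1 :=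
    scalarPart_eq hdim (by rwa [one_smul, hAeq])
  rw [logDetDiv, scalarPart_eq hdim hSγ, scalarPart_eq hdim hTγ, div_self hγ, extTrace, extDet,
    tracePart, tracePart, h1, hAeq, h0, one_smul, hAeq]
  simp

/-- The symmetrized relative perturbation `S^{-1/2} (T - S) S^{-1/2}`. -/
def relPert (T S : H →L[ℝ] H) : H →L[ℝ] H :=
  posSqrt (Ring.inverse S) * (T - S) * posSqrt (Ring.inverse S)

section RelPert

variable {S T : H →L[ℝ] H}

lemma posSqrt_inverse_mul_mul (hS : IsPosDef S) :
    posSqrt (Ring.inverse S) * (S * posSqrt (Ring.inverse S)) = 1 := by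
  obtain ⟨-, hGG⟩ := posSqrt_spec hS.inverse.1
  set G := posSqrt (Ring.inverse S)
  have h1 : S * (G * G) = 1 := by rw [hGG, Ring.mul_inverse_cancel _ hS.isUnit]
  have h2 : G * G * S = 1 := by rw [hGG, Ring.inverse_mul_cancel _ hS.isUnit]
  have h3 : G * S = S * G := by
    calc G * S = S * (G * G) * (G * S) := by rw [h1, one_mul]
      _ = S * G * (G * G * S) := by simp only [mul_assoc]
      _ = S * G := by rw [h2, mul_one]
  rw [← h3, ← mul_assoc, h2]

lemma mul_posSqrt_inverse_mul (hS : IsPosDef S) :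
    S * posSqrt (Ring.inverse S) * posSqrt (Ring.inverse S) = 1 := by
  rw [mul_assoc, (posSqrt_spec hS.inverse.1).2, Ring.mul_inverse_cancel _ hS.isUnit]

lemma inverse_mul_sub_eq_conj_relPert (hS : IsPosDef S) :
    Ring.inverse S * (T - S)
      = posSqrt (Ring.inverse S) * relPert T S * (S * posSqrt (Ring.inverse S)) := by
  have h1 := posSqrt_inverse_mul_mul hS
  have h2 := (posSqrt_spec hS.inverse.1).2
  set G := posSqrt (Ring.inverse S)
  calc Ring.inverse S * (T - S) = G * G * (T - S) * (G * (S * G)) := by rw [h1, h2, mul_one]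
    _ = G * (G * (T - S) * G) * (S * G) := by simp only [mul_assoc]

lemma isSelfAdjoint_relPert (hS : IsPosDef S) (hT : IsPosDef T) :
    IsSelfAdjoint (relPert T S) := by
  have hG := (posSqrt_spec hS.inverse.1).1.isSelfAdjoint.star_eq
  rw [IsSelfAdjoint, relPert, star_mul, star_mul, hG, star_sub, hS.1.isSelfAdjoint.star_eq,
    hT.1.isSelfAdjoint.star_eq, mul_assoc]

/-- `1 + S^{-1/2} (T - S) S^{-1/2} = S^{-1/2} T S^{-1/2}` is positive definite. -/
lemma one_add_pos_of_relPert_apply_eq (hS : IsPosDef S) (hT : IsPosDef T) {x : ℝ} {v : H}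
    (hv : ‖v‖ = 1) (h : relPert T S v = x • v) : 0 < 1 + x := by
  have h1 := posSqrt_inverse_mul_mul hS
  have h2 := mul_posSqrt_inverse_mul hS
  have hG := (posSqrt_spec hS.inverse.1).1
  rw [relPert] at h
  set G := posSqrt (Ring.inverse S)
  have h3 : G * (T - S) * G = G * (T * G) - 1 := by
    rw [mul_sub, sub_mul, mul_assoc, mul_assoc, h1]
  have h4 : G (T (G v)) = v + x • v := by
    rw [h3] at h
    have h5 : G (T (G v)) - v = x • v := h
    rw [← h5, add_sub_cancel]
  have h5 : ⟪T (G v), G v⟫ = 1 + x := by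
    rw [← hG.inner_left_eq_inner_right, h4, inner_add_left, real_inner_smul_left,
      real_inner_self_eq_norm_sq, hv]
    ring
  have h6 : G v ≠ 0 := by
    intro h0
    have h7 : (S * G) (G v) = v := congrArg (fun A : H →L[ℝ] H => A v) h2
    rw [h0, map_zero] at h7
    rw [← h7, norm_zero] at hv
    exact zero_ne_one hv
  obtain ⟨-, c, hc, hle⟩ := hT
  have := norm_pos_iff.2 h6
  rw [← h5]
  exact lt_of_lt_of_le (by positivity) (hle _)

lemma eq_of_relPert_eq_zero (hS : IsPosDef S) (h : relPert T S = 0) : T = S := by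
  have h1 : Ring.inverse S * (T - S) = 0 := by
    rw [inverse_mul_sub_eq_conj_relPert hS, h, mul_zero, zero_mul]
  have h2 : S * (Ring.inverse S * (T - S)) = T - S := by
    rw [← mul_assoc, Ring.mul_inverse_cancel _ hS.isUnit, one_mul]
  rw [h1, mul_zero] at h2
  exact (sub_eq_zero.1 h2.symm)

end RelPert

lemma eq_zero_of_forall_apply_basis_eq_zero {ι : Type*} (b : HilbertBasis ι ℝ H) {K : H →L[ℝ] H}
    (hs : IsSelfAdjoint K) (h : ∀ i, K (b i) = 0) : K = 0 := by
  ext x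
  have h1 := hasSum_inner_sq b (K x)
  have h2 (i : ι) : ⟪b i, K x⟫ = 0 := by
    have h3 : ⟪K (b i), x⟫ = ⟪b i, K x⟫ := hs.isSymmetric _ _
    rw [← h3, h, inner_zero_left]
  simp only [h2, ne_eq, OfNat.ofNat_ne_zero, not_false_eq_true, zero_pow] at h1
  simpa using h1.unique hasSum_zero

/-- With `λₖ` the eigenvalues of `S^{-1/2} (T - S) S^{-1/2}`, the divergence is
`∑ (λₖ - log (1 + λₖ))`, a sum of nonnegative terms that vanish only for `λₖ = 0`. -/
theorem logDetDiv_nonneg_and_eq_zero_iff (hdim : ¬ FiniteDimensional ℝ H) {S T : H →L[ℝ] H}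
    (hS : IsPosDef S) (hT : IsPosDef T) {γ : ℝ} (hγ : γ ≠ 0) (hSγ : S - γ • 1 ∈ nuclear H)
    (hTγ : T - γ • 1 ∈ nuclear H) :
    0 ≤ logDetDiv T S ∧ (logDetDiv T S = 0 ↔ T = S) := by
  have hK : relPert T S ∈ nuclear H := by
    have h1 := sub_mem hTγ hSγ
    rw [sub_sub_sub_cancel_right] at h1
    exact nuclear_mul_right (nuclear_mul_left h1 _) _
  have hKc := isCompactOperator_of_mem_nuclear hK
  have hKs := isSelfAdjoint_relPert hS hT
  obtain ⟨b, hb⟩ := exists_eigenbasis hKc hKs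
  have hpos (i : EigenIndex (relPert T S)) : 0 < 1 + i.1 :=
    one_add_pos_of_relPert_apply_eq hS hT (b.orthonormal.1 i) (hb i)
  have hl : Summable fun i : EigenIndex (relPert T S) => i.1 := by
    refine (summable_inner_of_mem_nuclear b hK).congr fun i => ?_
    rw [hb, real_inner_smul_right, real_inner_self_eq_norm_sq, b.orthonormal.1 i, one_pow, mul_one]
  have hlog := Real.summable_log_one_add_of_summable hl
  have hRG := mul_posSqrt_inverse_mul hS
  have hGR := posSqrt_inverse_mul_mul hS
  have hform : logDetDiv T S
      = ∑' i : EigenIndex (relPert T S), (i.1 - Real.log (1 + i.1)) := by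
    rw [logDetDiv_eq_trace_sub_log hdim hS hγ hSγ hTγ, inverse_mul_sub_eq_conj_relPert hS,
      trace_mul_mul_eq_tsum b hKs hb hl.abs hRG, fredholmDet_conj hRG hGR,
      fredholmDet_eq_exp_tsum hKc hKs hpos hl, Real.log_exp, hl.tsum_sub hlog]
  have hterm (i : EigenIndex (relPert T S)) : 0 ≤ i.1 - Real.log (1 + i.1) := by
    have := Real.log_le_sub_one_of_pos (hpos i)
    linarith
  rw [hform]
  refine ⟨tsum_nonneg hterm, fun h0 => eq_of_relPert_eq_zero hS ?_, fun h => ?_⟩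
  · refine eq_zero_of_forall_apply_basis_eq_zero b hKs fun i => ?_
    have h1 : i.1 - Real.log (1 + i.1) = 0 :=
      congrFun ((hasSum_zero_iff_of_nonneg hterm).1 (h0 ▸ (hl.sub hlog).hasSum)) i
    have h2 : i.1 = 0 := by
      by_contra hne
      have := Real.log_lt_sub_one_of_pos (hpos i) (by simpa only [ne_eq, add_eq_left] using hne)
      linarith
    rw [hb, h2, zero_smul]
  · have h1 (i : EigenIndex (relPert T S)) : i.1 = 0 := by
      have h2 : relPert T S = 0 := by rw [relPert, h, sub_self, mul_zero, zero_mul]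
      have h3 : i.1 • b i = 0 :=
        (hb i).symm.trans (congrArg (fun A : H →L[ℝ] H => A (b i)) h2)
      exact (smul_eq_zero.1 h3).resolve_right (b.orthonormal.ne_zero i)
    simp only [h1, add_zero, Real.log_one, sub_zero, tsum_zero]

end

/-! ### Gaussian measures -/

section Gaussian

variable {H : Type*} [NormedAddCommGroup H] [InnerProductSpace ℝ H] [CompleteSpace H]
  [MeasurableSpace H] [BorelSpace H]

open ContinuousLinearMap

lemma inner_cov (μ : Measure H) (x y : H) : ⟪cov μ x, y⟫ = covarianceBilin μ x y :=
  InnerProductSpace.continuousLinearMapOfBilin_apply _ _ _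

lemma isPositive_cov (μ : Measure H) : (cov μ).IsPositive := by
  refine isPositive_of_inner ?_ fun x => ?_
  · rw [isSelfAdjoint_iff_isSymmetric]
    intro x y
    have h1 := inner_cov μ x y
    have h2 := inner_cov μ y x
    rw [covarianceBilin_comm] at h2
    exact h1.trans (h2.symm.trans (real_inner_comm _ _))
  · rw [inner_cov]
    exact covarianceBilin_self_nonneg x

/-- The trace of the covariance is `∫ ‖z - m‖² dμ`, finite by Fernique's theorem. -/
lemma cov_mem_nuclear [SecondCountableTopology H] (μ : Measure H) [IsGaussian μ] :
    cov μ ∈ nuclear H := by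
  have hL : MemLp id 2 μ := IsGaussian.memLp_two_id
  have hL2 : MemLp (fun z => z - μ[id]) 2 μ := hL.sub (memLp_const _)
  have hI : Integrable (fun z => ‖z - μ[id]‖ ^ 2) μ := hL2.integrable_norm_pow two_ne_zero
  have hIe (x : H) : Integrable (fun z => ⟪x, z - μ[id]⟫ ^ 2) μ := (hL2.const_inner x).integrable_sq
  refine mem_nuclear_of_isPositive (isPositive_cov μ)
    (summable_of_sum_le (c := ∫ z, ‖z - μ[id]‖ ^ 2 ∂μ)
      (fun i => (isPositive_cov μ).inner_nonneg_right _) fun F => ?_)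
  have h1 (i) : ⟪onb H i, cov μ (onb H i)⟫ = ∫ z, ⟪onb H i, z - μ[id]⟫ ^ 2 ∂μ := by
    rw [real_inner_comm, inner_cov, covarianceBilin_apply hL]
    simp only [sq]
  simp only [h1]
  rw [← integral_finsetSum _ fun i _ => hIe _]
  refine integral_mono (integrable_finsetSum _ fun i _ => hIe _) hI fun z => ?_
  exact sum_le_hasSum F (fun _ _ => sq_nonneg _) (hasSum_inner_sq (onb H) _)

lemma eq_iff_mean_eq_and_cov_eq [SecondCountableTopology H] (μ₀ μ₁ : Measure H) [IsGaussian μ₀]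
    [IsGaussian μ₁] : μ₀ = μ₁ ↔ mean μ₀ = mean μ₁ ∧ cov μ₀ = cov μ₁ := by
  refine ⟨fun h => by simp [h], fun ⟨hm, hc⟩ => IsGaussian.ext hm ?_⟩
  ext x y
  rw [← inner_cov, ← inner_cov, hc]

variable {α γ : ℝ} {μ₀ μ₁ : Measure H}

lemma isPosDef_regCov (hγ : 0 < γ) (μ : Measure H) : IsPosDef (regCov γ μ) :=
  IsPosDef.add_smul_one (isPositive_cov μ) hγ

lemma regCov_sub_mem_nuclear [SecondCountableTopology H] (γ : ℝ) (μ : Measure H) [IsGaussian μ] :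
    regCov γ μ - γ • 1 ∈ nuclear H := by
  rw [regCov, add_sub_cancel_right]
  exact cov_mem_nuclear μ

lemma isPosDef_interp (hγ : 0 < γ) (hα0 : 0 < α) (hα1 : α < 1) (μ₀ μ₁ : Measure H) :
    IsPosDef ((1 - α) • Ring.inverse (regCov γ μ₀) + α • Ring.inverse (regCov γ μ₁)) :=
  ((isPosDef_regCov hγ μ₀).inverse.smul (sub_pos.2 hα1)).add
    ((isPosDef_regCov hγ μ₁).inverse.smul hα0)

/-- `γ⁻¹ - (C + γ)⁻¹ = γ⁻¹ (C + γ)⁻¹ C`. -/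
lemma inverse_sub_inverse_regCov_mem_nuclear [SecondCountableTopology H] (hγ : 0 < γ)
    (μ : Measure H) [IsGaussian μ] : γ⁻¹ • 1 - Ring.inverse (regCov γ μ) ∈ nuclear H := by
  have hu := (isPosDef_regCov hγ μ).isUnit
  have h1 : γ⁻¹ • 1 - Ring.inverse (regCov γ μ)
      = γ⁻¹ • (Ring.inverse (regCov γ μ) * (regCov γ μ - γ • 1)) := by
    rw [mul_sub, Ring.inverse_mul_cancel _ hu, mul_smul_comm, mul_one, smul_sub, smul_smul,
      inv_mul_cancel₀ hγ.ne', one_smul]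
  rw [h1]
  exact Submodule.smul_mem _ _ (nuclear_mul_left (regCov_sub_mem_nuclear γ μ) _)

/-- `S - γ = γ S (γ⁻¹ - S⁻¹)`, and `γ⁻¹ - S⁻¹` is a convex combination of `γ⁻¹ - (Cᵢ + γ)⁻¹`. -/
lemma interpCov_sub_mem_nuclear [SecondCountableTopology H] (hγ : 0 < γ) (hα0 : 0 < α)
    (hα1 : α < 1) (μ₀ μ₁ : Measure H) [IsGaussian μ₀] [IsGaussian μ₁] :
    interpCov α γ μ₀ μ₁ - γ • 1 ∈ nuclear H := by
  have hu := (isPosDef_interp hγ hα0 hα1 μ₀ μ₁).isUnit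
  have h0 := inverse_sub_inverse_regCov_mem_nuclear hγ μ₀
  have h1 := inverse_sub_inverse_regCov_mem_nuclear hγ μ₁
  have h2 : γ⁻¹ • 1 - ((1 - α) • Ring.inverse (regCov γ μ₀) + α • Ring.inverse (regCov γ μ₁))
      = (1 - α) • (γ⁻¹ • 1 - Ring.inverse (regCov γ μ₀))
        + α • (γ⁻¹ • 1 - Ring.inverse (regCov γ μ₁)) := by
    module
  rw [interpCov]
  set W := (1 - α) • Ring.inverse (regCov γ μ₀) + α • Ring.inverse (regCov γ μ₁)
  have h3 : Ring.inverse W - γ • 1 = γ • (Ring.inverse W * (γ⁻¹ • 1 - W)) := by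
    rw [mul_sub, Ring.inverse_mul_cancel _ hu, mul_smul_comm, mul_one, smul_sub, smul_smul,
      mul_inv_cancel₀ hγ.ne', one_smul]
  rw [h3, h2]
  exact Submodule.smul_mem _ _ (nuclear_mul_left
    (add_mem (Submodule.smul_mem _ _ h0) (Submodule.smul_mem _ _ h1)) _)

lemma isPosDef_interpCov (hγ : 0 < γ) (hα0 : 0 < α) (hα1 : α < 1) (μ₀ μ₁ : Measure H) :
    IsPosDef (interpCov α γ μ₀ μ₁) :=
  (isPosDef_interp hγ hα0 hα1 μ₀ μ₁).inverse

lemma eq_of_norm_posSqrt_sub_sq_eq_zero {A : H →L[ℝ] H} (hA : IsPosDef A) {x y : H}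
    (h : ‖posSqrt A (x - y)‖ ^ 2 = 0) : x = y := by
  have h1 : posSqrt A (x - y) = 0 := by simpa using h
  have h2 : A (x - y) = 0 := by
    have h3 := congrArg (fun B : H →L[ℝ] H => B (x - y)) (posSqrt_spec hA.1).2
    rw [← h3]
    change posSqrt A (posSqrt A (x - y)) = 0
    rw [h1, map_zero]
  have h4 := congrArg (fun B : H →L[ℝ] H => B (x - y)) (Ring.inverse_mul_cancel _ hA.isUnit)
  have h5 : Ring.inverse A (A (x - y)) = x - y := h4
  rw [h2, map_zero] at h5
  exact sub_eq_zero.1 h5.symm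

lemma interpCov_self (hγ : 0 < γ) (α : ℝ) (μ : Measure H) : interpCov α γ μ μ = regCov γ μ := by
  have hu := (isPosDef_regCov hγ μ).isUnit
  rw [interpCov, ← add_smul, sub_add_cancel, one_smul, Ring.inverse_inverse hu]

lemma interpMean_self (hγ : 0 < γ) (α : ℝ) (μ : Measure H) : interpMean α γ μ μ = mean μ := by
  have hu := (isPosDef_regCov hγ μ).isUnit
  rw [interpMean, interpCov_self hγ, ← add_smul, sub_add_cancel, one_smul]
  exact congrArg (fun B : H →L[ℝ] H => B (mean μ)) (Ring.mul_inverse_cancel _ hu)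

lemma regJS_self [SecondCountableTopology H] (hdim : ¬ FiniteDimensional ℝ H) (hγ : 0 < γ) (α : ℝ)
    (μ : Measure H) [IsGaussian μ] : regJS α γ μ μ = 0 := by
  rw [regJS, interpCov_self hγ, interpMean_self hγ,
    (logDetDiv_nonneg_and_eq_zero_iff hdim (isPosDef_regCov hγ μ) (isPosDef_regCov hγ μ) hγ.ne'
      (regCov_sub_mem_nuclear γ μ) (regCov_sub_mem_nuclear γ μ)).2.2 rfl,
    sub_self, map_zero, norm_zero]
  ring

end Gaussian

end RegJS
end

theorem mainTheorem4 {H : Type*} [NormedAddCommGroup H] [InnerProductSpace ℝ H]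
    [CompleteSpace H] [TopologicalSpace.SeparableSpace H] [MeasurableSpace H] [BorelSpace H]
    (hdim : ¬ FiniteDimensional ℝ H) (γ : ℝ) (hγ : 0 < γ) (α : ℝ) (hα0 : 0 < α) (hα1 : α < 1)
    (μ₀ μ₁ : Measure H) [IsGaussian μ₀] [IsGaussian μ₁] :
    0 ≤ RegJS.regJS α γ μ₀ μ₁ ∧
    (RegJS.regJS α γ μ₀ μ₁ = 0 ↔ μ₀ = μ₁) ∧
    (μ₀ = μ₁ ↔ RegJS.mean μ₀ = RegJS.mean μ₁ ∧ RegJS.cov μ₀ = RegJS.cov μ₁) := by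
  have : SecondCountableTopology H := UniformSpace.secondCountable_of_separable H
  have hS := RegJS.isPosDef_interpCov hγ hα0 hα1 μ₀ μ₁
  have hSγ := RegJS.interpCov_sub_mem_nuclear hγ hα0 hα1 μ₀ μ₁
  obtain ⟨hd0, hd0'⟩ := RegJS.logDetDiv_nonneg_and_eq_zero_iff hdim hS
    (RegJS.isPosDef_regCov hγ μ₀) hγ.ne' hSγ (RegJS.regCov_sub_mem_nuclear γ μ₀)
  obtain ⟨hd1, hd1'⟩ := RegJS.logDetDiv_nonneg_and_eq_zero_iff hdim hS
    (RegJS.isPosDef_regCov hγ μ₁) hγ.ne' hSγ (RegJS.regCov_sub_mem_nuclear γ μ₁)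
  have hiff := RegJS.eq_iff_mean_eq_and_cov_eq μ₀ μ₁
  have hβ : 0 < (1 - α) / 2 := half_pos (sub_pos.2 hα1)
  have hα : 0 < α / 2 := half_pos hα0
  have hn0 := mul_nonneg hβ.le (sq_nonneg ‖RegJS.posSqrt (Ring.inverse (RegJS.interpCov α γ μ₀ μ₁))
    (RegJS.mean μ₀ - RegJS.interpMean α γ μ₀ μ₁)‖)
  have hn1 := mul_nonneg hα.le (sq_nonneg ‖RegJS.posSqrt (Ring.inverse (RegJS.interpCov α γ μ₀ μ₁))
    (RegJS.mean μ₁ - RegJS.interpMean α γ μ₀ μ₁)‖)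
  have hl0 := mul_nonneg hβ.le hd0
  have hl1 := mul_nonneg hα.le hd1
  refine ⟨by rw [RegJS.regJS]; positivity, ⟨fun h => ?_, ?_⟩, hiff⟩
  · rw [RegJS.regJS] at h
    obtain ⟨h, e3⟩ := (add_eq_zero_iff_of_nonneg (by positivity) hl1).1 h
    obtain ⟨h, e2⟩ := (add_eq_zero_iff_of_nonneg (by positivity) hl0).1 h
    obtain ⟨e0, e1⟩ := (add_eq_zero_iff_of_nonneg hn0 hn1).1 h
    have m0 := RegJS.eq_of_norm_posSqrt_sub_sq_eq_zero hS.inverse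
      ((mul_eq_zero.1 e0).resolve_left hβ.ne')
    have m1 := RegJS.eq_of_norm_posSqrt_sub_sq_eq_zero hS.inverse
      ((mul_eq_zero.1 e1).resolve_left hα.ne')
    have c0 := hd0'.1 ((mul_eq_zero.1 e2).resolve_left hβ.ne')
    have c1 := hd1'.1 ((mul_eq_zero.1 e3).resolve_left hα.ne')
    exact hiff.2 ⟨m0.trans m1.symm, add_right_cancel (c0.trans c1.symm)⟩
  · rintro rfl
    exact RegJS.regJS_self hdim hγ α μ₀
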